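/- Let $q \ge 3$ be a prime power, let $m \ge 2$ be an even integer, and put $n = q^m - 1$. Then for every integer $c$ with $2 \le c \le q$ there exists a $q$-ary Calderbank--Shor--Steane (CSS) quantum code with parameters $$[[\,n,\; n - 2m(c-2) - m/2 - 1,\; d \ge c\,]]_q .$$ Here a quantum code with parameters $[[n,k,d \ge c]]_q$ (where $k \geq 0$ is an integer) is a subspace $Q$ of $(\mathbb{C}^q)^{\otimes n}$ of dimension $q^k$ whose minimum distance $d$ is at least $c$, meaning that for every linear operator $E$ on $(\mathbb{C}^q)^{\otimes n}$ that acts nontrivially on fewer than $c$ of the $n$ tensor factors there is a scalar $\mu \in \mathbb{C}$ with $\langle \varphi, E\psi\rangle = \mu \langle \varphi, \psi\rangle$ for all $\varphi, \psi \in Q$. Indexing the standard basis $|y\rangle$ of $(\mathbb{C}^q)^{\otimes n}$ by the vectors $y \in \mathbb{F}_q^n$, the code $Q$ is a CSS code if there are linear codes $C_2 \subseteq C_1 \subseteq \mathbb{F}_q^n$ such that $Q$ is spanned by the vectors $\sum_{u \in C_2} |x + u\rangle$ with $x \in C_1$. -/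

import Mathlib

namespace QuantumCode

/-- The state space `(ℂ^q)^{⊗ n}` of `n` qudits.  The computational basis of one qudit is indexed by
the finite field `F` (with `q` elements), hence that of `n` qudits by the vectors of `F^n`. -/
abbrev StateSpace (F : Type*) [Fintype F] (n : ℕ) : Type _ :=
  EuclideanSpace ℂ (Fin n → F)

open scoped Classical in
/-- The matrix, in the computational basis, of the operator `A_S ⊗ id` which acts as `A` on the
qudits at the positions in `S` and as the identity on all the other qudits. -/
noncomputable def localOperator {F : Type*} {n : ℕ} (S : Finset (Fin n))
    (A : Matrix (S → F) (S → F) ℂ) : Matrix (Fin n → F) (Fin n → F) ℂ :=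
  Matrix.of fun x y =>
    if ∀ i, i ∉ S → x i = y i then A (fun i => x i) (fun i => y i) else 0

open scoped Classical in
/-- The linear operator on the state space of `n` qudits which acts as `A` on the qudits in `S`
and trivially elsewhere. -/
noncomputable def errorOperator {F : Type*} [Fintype F] {n : ℕ} (S : Finset (Fin n))
    (A : Matrix (S → F) (S → F) ℂ) : StateSpace F n →ₗ[ℂ] StateSpace F n :=
  Matrix.toEuclideanLin (localOperator S A)

/-- The code `Q` detects the error `E`: there is a scalar `μ` with
`⟨φ, E ψ⟩ = μ ⟨φ, ψ⟩` for all states `φ, ψ` of `Q`; equivalently `P E P = μ P`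
for the orthogonal projection `P` onto `Q`. -/
def Detects {F : Type*} [Fintype F] {n : ℕ} (Q : Submodule ℂ (StateSpace F n))
    (E : StateSpace F n →ₗ[ℂ] StateSpace F n) : Prop :=
  ∃ μ : ℂ, ∀ φ ∈ Q, ∀ ψ ∈ Q, inner ℂ φ (E ψ) = μ * inner ℂ φ ψ

/-- The minimum distance of `Q` is at least `d`: every error which acts nontrivially on fewer than
`d` qudits is detected. -/
def DistanceAtLeast {F : Type*} [Fintype F] {n : ℕ} (Q : Submodule ℂ (StateSpace F n))
    (d : ℕ) : Prop :=
  ∀ S : Finset (Fin n), S.card < d → ∀ A : Matrix (S → F) (S → F) ℂ,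
    Detects Q (errorOperator S A)

/-- `Q` is a quantum code with parameters `[[n, k, ≥ d]]_q`, where `q = |F|`: a `q^k`-dimensional
subspace of the state space of `n` qudits whose minimum distance is at least `d`. -/
structure HasParameters {F : Type*} [Fintype F] {n : ℕ} (Q : Submodule ℂ (StateSpace F n))
    (k d : ℕ) : Prop where
  dim_eq : Module.finrank ℂ Q = Fintype.card F ^ k
  distance : DistanceAtLeast Q d

open scoped Classical in
/-- The (unnormalised) coset state `|x + C₂⟩ = ∑_{y ∈ x + C₂} |y⟩`. -/
noncomputable def cosetState {F : Type*} [Field F] [Fintype F] {n : ℕ}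
    (C₂ : Submodule F (Fin n → F)) (x : Fin n → F) : StateSpace F n :=
  WithLp.toLp 2 fun y => if y - x ∈ C₂ then 1 else 0

/-- The Calderbank-Shor-Steane code of a pair of linear codes `C₂ ⊆ C₁` in `F^n`: the span
of the coset states `|x + C₂⟩` with `x ∈ C₁`. -/
noncomputable def cssCode {F : Type*} [Field F] [Fintype F] {n : ℕ}
    (C₁ C₂ : Submodule F (Fin n → F)) : Submodule ℂ (StateSpace F n) :=
  Submodule.span ℂ (cosetState C₂ '' (C₁ : Set (Fin n → F)))

/-- `Q` is a Calderbank-Shor-Steane code, i.e. it arises from a pair of nested linear codes. -/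
def IsCSS {F : Type*} [Field F] [Fintype F] {n : ℕ} (Q : Submodule ℂ (StateSpace F n)) : Prop :=
  ∃ C₁ C₂ : Submodule F (Fin n → F), C₂ ≤ C₁ ∧ Q = cssCode C₁ C₂

end QuantumCode

namespace QuantumCode

open Module

/-! ### CSS codes from nested linear codes -/

section

variable {F : Type*} [Field F] [Fintype F] {n : ℕ}

/-! Write `m = 2h` and `c = e + 2`, and let `α` generate the units of the extension `K` of degree
`2h`. Take `C₁` cyclic with zeros `α^b, …, α^(b+e)`, where `b + e = q^h + 1`, and `C₂` the trace
code whose dual has zeros `1, …, α^e`. Both `C₁` and the dual of `C₂` have `e + 1` consecutive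
zeros, so the BCH bound gives them distance at least `c`, which the CSS code inherits
(`distanceAtLeast_cssCode`).

The dimension comes from two cheap zeros: `1` costs one check, and `α^(q^h+1)`, fixed by `z ↦
z^(q^h)`, costs at most `h`. The other `2e` zeros cost at most `2h` each, in total `4he + h + 1`
(`le_finrank_bchCode`, `finrank_range_traceMap_le`).

Nesting holds because a trace is a sum of Frobenius conjugates: evaluating a trace word at a zero of
`C₁` gives full geometric sums, which vanish (`range_traceMap_le_bchCode`). -/

open scoped Classical in
theorem cosetState_apply (C₂ : Submodule F (Fin n → F)) (x y : Fin n → F) :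
    cosetState C₂ x y = if y - x ∈ C₂ then 1 else 0 := rfl

open scoped Classical in
/-- The coset state of an element of the quotient by `C₂`. -/
noncomputable def quotientState (C₂ : Submodule F (Fin n → F))
    (z : (Fin n → F) ⧸ C₂) : StateSpace F n :=
  WithLp.toLp 2 fun y => if C₂.mkQ y = z then 1 else 0

theorem cosetState_eq_quotientState (C₂ : Submodule F (Fin n → F)) (x : Fin n → F) :
    cosetState C₂ x = quotientState C₂ (C₂.mkQ x) := by
  ext y
  classical
  exact if_congr (Submodule.Quotient.eq C₂).symm rfl rfl

/-- Distinct cosets have disjoint supports, so reading a relation at a representative isolates one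
coefficient. -/
theorem linearIndependent_quotientState (C₂ : Submodule F (Fin n → F)) :
    LinearIndependent ℂ (quotientState C₂) := by
  classical
  have : Fintype ((Fin n → F) ⧸ C₂) := Fintype.ofFinite _
  rw [Fintype.linearIndependent_iff]
  intro g hg z
  obtain ⟨y, rfl⟩ := C₂.mkQ_surjective z
  have h := congrArg (fun v : StateSpace F n => v y) hg
  classical
  simpa [quotientState, -Submodule.mkQ_apply] using h

/-- The dimension of a CSS code is the number of cosets of `C₂` in `C₁`. -/
theorem finrank_cssCode (C₁ C₂ : Submodule F (Fin n → F)) :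
    finrank ℂ (cssCode C₁ C₂) = Fintype.card F ^ finrank F (C₁.map C₂.mkQ) := by
  have : Fintype (C₁.map C₂.mkQ) := Fintype.ofFinite _
  have hli := (linearIndependent_quotientState C₂).comp
    (fun z : C₁.map C₂.mkQ => (z : (Fin n → F) ⧸ C₂)) Subtype.val_injective
  have hspan : cssCode C₁ C₂ = Submodule.span ℂ (Set.range (quotientState C₂ ∘
      fun z : C₁.map C₂.mkQ => (z : (Fin n → F) ⧸ C₂))) := by
    unfold cssCode
    congr 1
    ext v
    simp only [Set.mem_image, Set.mem_range, Function.comp_apply, cosetState_eq_quotientState]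
    constructor
    · rintro ⟨x, hx, rfl⟩
      exact ⟨⟨_, Submodule.mem_map_of_mem hx⟩, rfl⟩
    · rintro ⟨⟨_, x, hx, rfl⟩, rfl⟩
      exact ⟨x, hx, rfl⟩
  rw [hspan, finrank_span_eq_card hli, Module.card_eq_pow_finrank (K := F)]

omit [Fintype F] in
/-- If every nonzero vector supported on `S` fails to be orthogonal to `C`, then every vector on
the positions in `S` extends to a codeword of `C`. -/
theorem exists_mem_eq_on_of_orthogonal (C : Submodule F (Fin n → F)) (S : Finset (Fin n))
    (hC : ∀ x : Fin n → F, (∀ i, i ∉ S → x i = 0) → (∀ u ∈ C, ∑ i, x i * u i = 0) → x = 0)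
    (w : Fin n → F) : ∃ u ∈ C, ∀ i ∈ S, u i = w i := by
  classical
  let r : (Fin n → F) →ₗ[F] (S → F) := LinearMap.funLeft F F Subtype.val
  have htop : C.map r = ⊤ := by
    by_contra hne
    -- A functional killing the restriction of `C` to `S`, extended by zero, is a dual word
    -- supported on `S`.
    obtain ⟨f, hf, hle⟩ := Submodule.exists_le_ker_of_lt_top _ (lt_top_iff_ne_top.mpr hne)
    apply hf
    let x : Fin n → F := fun i => if h : i ∈ S then f (Pi.single ⟨i, h⟩ 1) else 0
    have hfx (v : Fin n → F) : f (r v) = ∑ i, x i * v i := by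
      have h1 : r v = ∑ i : S, v i • Pi.single i (1 : F) := by
        ext j
        simp [r, Finset.sum_apply, Pi.single_apply]
      rw [h1, map_sum, ← Finset.sum_subset (Finset.subset_univ S)
        (fun i _ hi => by simp [x, hi]), ← Finset.sum_coe_sort S]
      refine Finset.sum_congr rfl fun i _ => ?_
      simp [x, mul_comm]
    have hx : x = 0 := by
      refine hC x (fun i hi => by simp [x, hi]) fun u hu => ?_
      rw [← hfx]
      exact hle (Submodule.mem_map_of_mem hu)
    ext i
    have := congrFun hx i
    simpa [x] using this
  obtain ⟨u, hu, huw⟩ : r w ∈ C.map r := htop ▸ Submodule.mem_top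
  exact ⟨u, hu, fun i hi => congrFun huw ⟨i, hi⟩⟩

theorem inner_cosetState_errorOperator (C₂ : Submodule F (Fin n → F)) (S : Finset (Fin n))
    (A : Matrix (S → F) (S → F) ℂ) (x x' : Fin n → F) :
    inner ℂ (cosetState C₂ x) (errorOperator S A (cosetState C₂ x')) =
      ∑ y, ∑ y', cosetState C₂ x y * localOperator S A y y' * cosetState C₂ x' y' := by
  classical
  rw [PiLp.inner_apply]
  refine Finset.sum_congr rfl fun y _ => ?_
  simp only [errorOperator, Matrix.toEuclideanLin, RCLike.inner_apply]
  simp only [Matrix.mulVec, dotProduct, Matrix.toLpLin_apply, cosetState_apply,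
    Finset.sum_mul]
  refine Finset.sum_congr rfl fun y' _ => ?_
  split_ifs <;> simp_all

theorem inner_cosetState (C₂ : Submodule F (Fin n → F)) (x x' : Fin n → F) :
    inner ℂ (cosetState C₂ x) (cosetState C₂ x') =
      ∑ y, cosetState C₂ x y * cosetState C₂ x' y := by
  classical
  rw [PiLp.inner_apply]
  refine Finset.sum_congr rfl fun y _ => ?_
  simp only [cosetState_apply]
  split_ifs <;> simp

/-- A pair of nested codes such that neither `C₁` nor the dual of `C₂` has nonzero words of weight
less than `d` yields a CSS code of minimum distance at least `d`. -/
theorem distanceAtLeast_cssCode {C₁ C₂ : Submodule F (Fin n → F)} (h : C₂ ≤ C₁) {d : ℕ}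
    (h₁ : ∀ S : Finset (Fin n), S.card < d → ∀ x ∈ C₁, (∀ i, i ∉ S → x i = 0) → x = 0)
    (h₂ : ∀ S : Finset (Fin n), S.card < d → ∀ x : Fin n → F, (∀ i, i ∉ S → x i = 0) →
      (∀ u ∈ C₂, ∑ i, x i * u i = 0) → x = 0) :
    DistanceAtLeast (cssCode C₁ C₂) d := by
  classical
  intro S hS A
  let g : (Fin n → F) → ℂ := fun u => A (fun i => u i) (fun i => u i)
  let N : ℂ := ∑ u, if u ∈ C₂ then g u else 0
  let M : ℂ := ∑ u : Fin n → F, if u ∈ C₂ then 1 else 0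
  have hM : M ≠ 0 := by
    simp only [M, Finset.sum_boole, Nat.cast_ne_zero]
    exact Finset.card_ne_zero_of_mem (a := 0) (by simp)
  have shift (x : Fin n → F) : ∑ y, (if y - x ∈ C₂ then g y else 0) = N := by
    -- Translation by `w - x` carries `x + C₂` onto `C₂` and fixes the coordinates in `S`, the only
    -- ones `g` sees.
    obtain ⟨w, hw, hwx⟩ := exists_mem_eq_on_of_orthogonal C₂ S (h₂ S hS) x
    refine Fintype.sum_equiv (Equiv.addRight (w - x)) _ _ fun y => ?_
    have hmem : y + (w - x) ∈ C₂ ↔ y - x ∈ C₂ := by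
      rw [show y + (w - x) = y - x + w by abel]
      exact C₂.add_mem_iff_left hw
    have hg : g (y + (w - x)) = g y := by
      have : (fun i : S => (y + (w - x)) i) = fun i : S => y i := by
        ext i
        simp [hwx i i.2]
      simp only [g, this]
    simp [hmem, hg]
  have shiftM (x : Fin n → F) : ∑ y, (if y - x ∈ C₂ then (1 : ℂ) else 0) = M :=
    Fintype.sum_equiv (Equiv.subRight x) _ _ fun y => by simp
  have same {x x' : Fin n → F} (hxx : x - x' ∈ C₂) (y : Fin n → F) :
      y - x' ∈ C₂ ↔ y - x ∈ C₂ := by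
    rw [show y - x' = y - x + (x - x') by abel]
    exact C₂.add_mem_iff_left hxx
  have key : ∀ x ∈ C₁, ∀ x' ∈ C₁,
      inner ℂ (cosetState C₂ x) (errorOperator S A (cosetState C₂ x')) =
        N / M * inner ℂ (cosetState C₂ x) (cosetState C₂ x') := by
    intro x hx x' hx'
    have diag : inner ℂ (cosetState C₂ x) (errorOperator S A (cosetState C₂ x')) =
        ∑ y, cosetState C₂ x y * cosetState C₂ x' y * g y := by
      rw [inner_cosetState_errorOperator]
      refine Finset.sum_congr rfl fun y _ => ?_
      rw [Finset.sum_eq_single y]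
      · simp only [localOperator, Matrix.of_apply, implies_true, if_true, g]
        ring
      · intro y' _ hne
        simp only [cosetState_apply, localOperator, Matrix.of_apply]
        by_cases hy : y - x ∈ C₂
        · by_cases hy' : y' - x' ∈ C₂
          · rw [if_neg (c := ∀ i, i ∉ S → y i = y' i), mul_zero, zero_mul]
            intro hS'
            apply hne
            have hmem : y - y' ∈ C₁ := by
              rw [show y - y' = (y - x) + x - ((y' - x') + x') by abel]
              exact C₁.sub_mem (C₁.add_mem (h hy) hx) (C₁.add_mem (h hy') hx')
            exact (sub_eq_zero.mp (h₁ S hS _ hmem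
              fun i hi => by simp [hS' i hi])).symm
          · simp [hy']
        · simp [hy]
      · simp
    rw [diag, inner_cosetState]
    by_cases hxx : x - x' ∈ C₂
    · have hN : ∑ y, cosetState C₂ x y * cosetState C₂ x' y * g y = N := by
        rw [← shift x]
        refine Finset.sum_congr rfl fun y _ => ?_
        simp only [cosetState_apply, same hxx]
        split_ifs <;> simp
      have hM' : ∑ y, cosetState C₂ x y * cosetState C₂ x' y = M := by
        rw [← shiftM x]
        refine Finset.sum_congr rfl fun y _ => ?_
        simp only [cosetState_apply, same hxx]
        split_ifs <;> simp
      rw [hN, hM', div_mul_cancel₀ _ hM]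
    · have h0 (y : Fin n → F) : cosetState C₂ x y * cosetState C₂ x' y = 0 := by
        simp only [cosetState_apply]
        by_cases hy : y - x ∈ C₂
        · rw [if_neg (c := y - x' ∈ C₂), mul_zero]
          intro hy'
          apply hxx
          rw [show x - x' = (y - x') - (y - x) by abel]
          exact C₂.sub_mem hy' hy
        · simp [hy]
      simp [h0]
  refine ⟨N / M, fun φ hφ ψ hψ => ?_⟩
  induction hφ using Submodule.span_induction with
  | zero => simp
  | add a b _ _ ha hb => rw [inner_add_left, inner_add_left, ha, hb, mul_add]
  | smul r a _ ha => rw [inner_smul_left, inner_smul_left, ha]; ring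
  | mem a ha =>
    obtain ⟨x, hx, rfl⟩ := ha
    induction hψ using Submodule.span_induction with
    | zero => simp
    | add a b _ _ ha hb => rw [map_add, inner_add_right, inner_add_right, ha, hb, mul_add]
    | smul r a _ ha => rw [map_smul, inner_smul_right, inner_smul_right, ha]; ring
    | mem a ha =>
      obtain ⟨x', hx', rfl⟩ := ha
      exact key x hx x' hx'

/-- Nested codes whose dimensions differ by at least `k`, such that neither `C₁` nor the dual of
`C₂` has nonzero words of weight less than `d`, yield an `[[n, k, ≥ d]]` CSS code. -/
theorem exists_isCSS_hasParameters {C₁ C₂ : Submodule F (Fin n → F)} (h : C₂ ≤ C₁) {k d : ℕ}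
    (hk : finrank F C₂ + k ≤ finrank F C₁)
    (h₁ : ∀ S : Finset (Fin n), S.card < d → ∀ x ∈ C₁, (∀ i, i ∉ S → x i = 0) → x = 0)
    (h₂ : ∀ S : Finset (Fin n), S.card < d → ∀ x : Fin n → F, (∀ i, i ∉ S → x i = 0) →
      (∀ u ∈ C₂, ∑ i, x i * u i = 0) → x = 0) :
    ∃ Q : Submodule ℂ (StateSpace F n), IsCSS Q ∧ HasParameters Q k d := by
  have hdim : k ≤ finrank F (C₁.map C₂.mkQ) := by
    have h3 := LinearMap.finrank_range_add_finrank_ker (C₂.mkQ.domRestrict C₁)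
    rw [LinearMap.range_domRestrict, LinearMap.ker_domRestrict, Submodule.ker_mkQ,
      LinearEquiv.finrank_eq (Submodule.comapSubtypeEquivOfLe h)] at h3
    omega
  -- To hit `k` exactly, `C₁` is shrunk to the preimage of a `k`-dimensional subspace of `C₁/C₂`; a
  -- subcode keeps the distance.
  obtain ⟨f, hf⟩ := (finrank_le_iff_exists_linearMap (R := F) (M := Fin k → F)
    (M' := C₁.map C₂.mkQ)).mp (by simpa using hdim)
  let P := LinearMap.range ((C₁.map C₂.mkQ).subtype ∘ₗ f)
  have hP : finrank F P = k := by
    rw [LinearMap.finrank_range_of_inj]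
    · simp
    · exact Subtype.val_injective.comp hf
  have hmap : (P.comap C₂.mkQ).map C₂.mkQ = P :=
    Submodule.map_comap_eq_of_surjective C₂.mkQ_surjective _
  have hle : P.comap C₂.mkQ ≤ C₁ := by
    rintro x ⟨v, hv⟩
    obtain ⟨y, hy, hyx⟩ := (f v).2
    have hxy : x - y ∈ C₂ := by
      rw [← Submodule.Quotient.eq]
      exact (hyx.trans hv).symm
    simpa using C₁.add_mem (h hxy) hy
  have hC₂ : C₂ ≤ P.comap C₂.mkQ := by
    intro x hx
    have : C₂.mkQ x = 0 := by simpa using hx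
    simp [Submodule.mem_comap, this]
  refine ⟨cssCode (P.comap C₂.mkQ) C₂, ⟨_, _, hC₂, rfl⟩, ?_, ?_⟩
  · rw [finrank_cssCode, hmap, hP]
  · exact distanceAtLeast_cssCode hC₂ (fun S hS x hx => h₁ S hS x (hle hx)) h₂

end
-- The BCH bound and vanishing geometric sums
section

/-- The Bose-Chaudhuri-Hocquenghem bound: a vector supported on at most `N` positions with `N`
consecutive vanishing weighted power sums is zero. -/
theorem eq_zero_of_sum_mul_pow_eq_zero {K : Type*} [Field K] {n N : ℕ} {f : Fin n → K}
    (hf : Function.Injective f) {S : Finset (Fin n)} (hS : S.card ≤ N) {v : Fin n → K}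
    (hv : ∀ s, s ∉ S → v s = 0) (h : ∀ i < N, ∑ s, v s * f s ^ i = 0) : v = 0 := by
  let e := S.equivFin
  have h0 : (fun j => v (e.symm j)) = 0 := by
    refine Matrix.eq_zero_of_forall_pow_sum_mul_pow_eq_zero (f := fun j => f (e.symm j))
      (hf.comp (Subtype.val_injective.comp e.symm.injective)) fun i => ?_
    rw [← h i (i.2.trans_le hS), ← Finset.sum_subset (Finset.subset_univ S)
      (fun s _ hs => by simp [hv s hs]), ← Finset.sum_coe_sort S]
    exact Fintype.sum_equiv e.symm _ _ fun j => rfl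
  ext s
  by_cases hs : s ∈ S
  · simpa using congrFun h0 (e ⟨s, hs⟩)
  · exact hv s hs

theorem sum_pow_mul_eq_zero {K : Type*} [Field K] {n : ℕ} {α : K} (hα : IsPrimitiveRoot α n)
    {a : ℕ} (ha : 0 < a) (han : a < n) : ∑ s : Fin n, α ^ (a * (s : ℕ)) = 0 := by
  have h := mul_geom_sum (α ^ a) n
  rw [← pow_mul, mul_comm a n, pow_mul, hα.pow_eq_one, one_pow, sub_self, mul_eq_zero,
    sub_eq_zero] at h
  rw [← h.resolve_left (hα.pow_ne_one_of_pos_of_lt ha.ne' han), Finset.sum_range]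
  simp only [pow_mul]

/-! ### Cyclic codes, trace codes and their duality -/

variable (F : Type*) [Field F] [Fintype F] {K : Type*} [Field K] [Fintype K] [Algebra F K]
  (n : ℕ) (α : K)

/-- The evaluation `x ↦ ∑ xₛ α^{bs}` of the polynomial with coefficients `x` at `α^b`. -/
noncomputable def evalPow (b : ℕ) : (Fin n → F) →ₗ[F] K :=
  Fintype.linearCombination F fun s : Fin n => α ^ (b * (s : ℕ))

/-- The cyclic code of length `n` with zeros `α^b, …, α^{b+e}`. -/
noncomputable def bchCode (b e : ℕ) : Submodule F (Fin n → F) :=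
  ⨅ i : Fin (e + 1), LinearMap.ker (evalPow F n α (b + i))

/-- The parametrisation, by traces, of the dual of the cyclic code with zeros
`1, α, …, α^e`. -/
noncomputable def traceMap (e : ℕ) : F × (Fin e → K) →ₗ[F] (Fin n → F) :=
  LinearMap.pi fun s => LinearMap.fst F F (Fin e → K) +
    ∑ i : Fin e, Algebra.trace F K ∘ₗ LinearMap.mulRight F (α ^ ((i + 1 : ℕ) * (s : ℕ))) ∘ₗ
      LinearMap.proj i ∘ₗ LinearMap.snd F F (Fin e → K)

variable {F n α}

omit [Fintype F] [Fintype K] in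
theorem evalPow_apply (b : ℕ) (x : Fin n → F) :
    evalPow F n α b x = ∑ s, x s • α ^ (b * (s : ℕ)) := rfl

omit [Fintype F] [Fintype K] in
theorem traceMap_apply (e : ℕ) (y : F × (Fin e → K)) (s : Fin n) :
    traceMap F n α e y s =
      y.1 + ∑ i : Fin e, Algebra.trace F K (y.2 i * α ^ ((i + 1 : ℕ) * (s : ℕ))) := by
  simp [traceMap]

omit [Fintype F] [Fintype K] in
theorem mem_bchCode {b e : ℕ} {x : Fin n → F} :
    x ∈ bchCode F n α b e ↔ ∀ i ≤ e, evalPow F n α (b + i) x = 0 := by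
  simp only [bchCode, Submodule.mem_iInf, LinearMap.mem_ker]
  exact ⟨fun h i hi => h ⟨i, by omega⟩, fun h i => h i (by omega)⟩

omit [Fintype F] [Fintype K] in
-- The nonzero weights `α^(bs)` absorb the offset `b`, so that the vanishing power sums start at
-- exponent `0`.
theorem eq_zero_of_mem_bchCode (hα : IsPrimitiveRoot α n) {b e : ℕ} {S : Finset (Fin n)}
    (hS : S.card < e + 2) {x : Fin n → F} (hx : x ∈ bchCode F n α b e)
    (hxS : ∀ s, s ∉ S → x s = 0) : x = 0 := by
  rcases Nat.eq_zero_or_pos n with rfl | hn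
  · exact Subsingleton.elim _ _
  have hα0 : α ≠ 0 := hα.ne_zero hn.ne'
  have hf : Function.Injective fun s : Fin n => α ^ (s : ℕ) := fun s t hst =>
    Fin.ext (hα.pow_inj s.2 t.2 hst)
  have h := eq_zero_of_sum_mul_pow_eq_zero hf (N := e + 1) (by omega : S.card ≤ e + 1)
    (v := fun s => algebraMap F K (x s) * α ^ (b * (s : ℕ)))
    (fun s hs => by simp [hxS s hs]) (fun i hi => by
      rw [← mem_bchCode.mp hx i (by omega), evalPow_apply]
      refine Finset.sum_congr rfl fun s _ => ?_
      rw [Algebra.smul_def]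
      ring)
  ext s
  simpa [hα0] using congrFun h s

/-- The `t`-th conjugate in the trace contributes a geometric sum of ratio `α^(a q^t + b)`; the
exponent lies strictly between `0` and `n`, so the sum vanishes. -/
theorem evalPow_trace_eq_zero (hα : IsPrimitiveRoot α n) {a b : ℕ} (hb : 0 < b)
    (hab : ∀ t < finrank F K, a * Fintype.card F ^ t + b < n) (y : K) :
    evalPow F n α b (fun s => Algebra.trace F K (y * α ^ (a * (s : ℕ)))) = 0 := by
  simp_rw [evalPow_apply, Algebra.smul_def, FiniteField.algebraMap_trace_eq_sum_pow,
    Nat.card_eq_fintype_card, Finset.sum_mul]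
  rw [Finset.sum_comm]
  refine Finset.sum_eq_zero fun t ht => ?_
  have h := sum_pow_mul_eq_zero hα (a := a * Fintype.card F ^ t + b) (by omega)
    (hab t (Finset.mem_range.mp ht))
  rw [← mul_zero (y ^ Fintype.card F ^ t), ← h, Finset.mul_sum]
  refine Finset.sum_congr rfl fun s _ => ?_
  ring

theorem range_traceMap_le_bchCode (hα : IsPrimitiveRoot α n) {b e e' : ℕ} (hb : 0 < b)
    (hab : ∀ t < finrank F K, e * Fintype.card F ^ t + (b + e') < n) :
    LinearMap.range (traceMap F n α e) ≤ bchCode F n α b e' := by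
  rintro _ ⟨y, rfl⟩
  rw [mem_bchCode]
  intro j hj
  have hsplit : traceMap F n α e y = y.1 • (fun _ => 1) +
      ∑ i : Fin e, fun s : Fin n =>
        Algebra.trace F K (y.2 i * α ^ ((i + 1 : ℕ) * (s : ℕ))) := by
    ext s
    simp [traceMap_apply, Finset.sum_apply]
  have hpos : 0 < finrank F K := finrank_pos
  rw [hsplit, map_add, map_sum, map_smul]
  have h0 : evalPow F n α (b + j) (fun _ => 1) = 0 := by
    have := hab 0 hpos
    simpa [evalPow_apply] using sum_pow_mul_eq_zero hα (a := b + j) (by omega) (by omega)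
  rw [h0, smul_zero, zero_add]
  refine Finset.sum_eq_zero fun i _ => evalPow_trace_eq_zero hα (by omega) (fun t ht => ?_) _
  have h1 := hab t ht
  have h2 : (i + 1 : ℕ) * Fintype.card F ^ t ≤ e * Fintype.card F ^ t :=
    Nat.mul_le_mul_right _ i.2
  omega

theorem mem_bchCode_of_orthogonal_range_traceMap {e : ℕ} {x : Fin n → F}
    (hx : ∀ u ∈ LinearMap.range (traceMap F n α e), ∑ s, x s * u s = 0) :
    x ∈ bchCode F n α 0 e := by
  classical
  rw [mem_bchCode]
  intro i hi
  rw [zero_add]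
  rcases i with _ | i
  · have h := hx _ ⟨(1, 0), rfl⟩
    simp only [traceMap_apply] at h
    have h' := congrArg (algebraMap F K) h
    simpa [evalPow_apply, Algebra.smul_def] using h'
  -- Orthogonality to all trace words with parameter `y` in slot `i` says that the evaluation at
  -- `α^(i+1)` is trace-orthogonal to all of `K`.
  · refine (traceForm_nondegenerate F K).1 _ fun y => ?_
    rw [Algebra.traceForm_apply, evalPow_apply, Finset.sum_mul, map_sum,
      ← hx _ ⟨(0, Pi.single ⟨i, hi⟩ y), rfl⟩]
    refine Finset.sum_congr rfl fun s _ => ?_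
    rw [traceMap_apply, Finset.sum_eq_single ⟨i, hi⟩]
    · simp [mul_comm]
    · intro j _ hj
      simp [Pi.single_eq_of_ne hj]
    · simp

/-! ### Dimension bounds -/

omit [Fintype F] in
theorem finrank_range_traceMap_le (e : ℕ) :
    finrank F (LinearMap.range (traceMap F n α e)) ≤ 1 + e * finrank F K := by
  refine (LinearMap.finrank_range_le _).trans ?_
  simp [finrank_prod, finrank_pi_fintype]

/-- The values of polynomials over `F` at an element of the fixed field of the `h`-th power of the
Frobenius lie in this field, which has dimension at most `h`. -/
theorem finrank_range_evalPow_le {b h : ℕ} (hh : h ≠ 0)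
    (hb : (α ^ b) ^ Fintype.card F ^ h = α ^ b) :
    finrank F (LinearMap.range (evalPow F n α b)) ≤ h := by
  classical
  have hq : 1 < Fintype.card F := Fintype.one_lt_card
  have hroot : ∀ z ∈ LinearMap.range (evalPow F n α b), z ^ Fintype.card F ^ h = z := by
    rintro _ ⟨x, rfl⟩
    have hφ (z : K) : (FiniteField.frobeniusAlgEquivOfAlgebraic F K ^ h) z =
        z ^ Fintype.card F ^ h := by
      rw [AlgEquiv.coe_pow, FiniteField.coe_frobeniusAlgEquivOfAlgebraic_iterate]
    rw [← hφ, evalPow_apply, map_sum]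
    refine Finset.sum_congr rfl fun s _ => ?_
    rw [map_smul, hφ, pow_mul, pow_right_comm, hb]
  -- The range consists of roots of `X^(q^h) - X`, so it has at most `q^h` elements.
  have hne := FiniteField.X_pow_card_pow_sub_X_ne_zero K hh hq
  have hcard : Fintype.card (LinearMap.range (evalPow F n α b)) ≤ Fintype.card F ^ h := by
    rw [← FiniteField.X_pow_card_pow_sub_X_natDegree_eq K hh hq]
    refine le_trans ?_ (Polynomial.card_roots' _)
    refine le_trans ?_ (Multiset.toFinset_card_le _)
    rw [← Fintype.card_coe]
    refine Fintype.card_le_of_injective (fun z => ⟨z.1, ?_⟩) fun z w hzw =>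
      Subtype.ext (congrArg (fun t => t.1) hzw)
    simp [hne, hroot z.1 z.2]
  rw [Module.card_eq_pow_finrank (K := F)] at hcard
  exact (Nat.pow_le_pow_iff_right hq).mp hcard

theorem le_finrank_bchCode {b e h : ℕ} (hh : h ≠ 0)
    (hb : (α ^ (b + e)) ^ Fintype.card F ^ h = α ^ (b + e)) :
    n ≤ finrank F (bchCode F n α b e) + (h + e * finrank F K) := by
  -- The last evaluation is restricted to its range so that it counts for `h` checks instead of
  -- `finrank F K`.
  let T := (evalPow F n α (b + e)).rangeRestrict.prod
    (LinearMap.pi fun i : Fin e => evalPow F n α (b + i))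
  have hT : LinearMap.ker T ≤ bchCode F n α b e := by
    intro x hx
    have hx := Prod.mk_eq_zero.mp hx
    rw [mem_bchCode]
    intro i hi
    rcases hi.eq_or_lt with rfl | hi
    · exact congrArg Subtype.val hx.1
    · exact congrFun hx.2 ⟨i, hi⟩
  have h1 := LinearMap.finrank_range_add_finrank_ker T
  have h2 := Submodule.finrank_le (LinearMap.range T)
  have h3 := Submodule.finrank_mono hT
  have h4 := finrank_range_evalPow_le (F := F) (n := n) hh hb
  simp only [finrank_prod, finrank_pi_fintype, Finset.sum_const, Finset.card_univ,
    Fintype.card_fin, smul_eq_mul, finrank_self, mul_one] at h1 h2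
  omega

end

/-- With `e ≤ q - 2` this gives `4he + h + 1 ≤ n`, so the natural-number subtraction defining `k`
does not truncate. -/
theorem two_mul_mul_add_le_pow {q h : ℕ} (hq : 3 ≤ q) (hh : 1 ≤ h) :
    4 * h * (q - 2) + h + 2 ≤ q ^ (2 * h) := by
  obtain ⟨r, rfl⟩ := Nat.exists_eq_add_of_le hq
  rw [show 3 + r - 2 = r + 1 by omega]
  induction h, hh using Nat.le_induction with
  | base => ring_nf; nlinarith
  | succ h hh ih =>
    rw [show 2 * (h + 1) = 2 * h + 2 by ring, pow_add]
    nlinarith [Nat.zero_le r, Nat.zero_le (h * r), Nat.mul_le_mul ih (le_refl ((3 + r) ^ 2)),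
      Nat.zero_le (h * r * r), Nat.zero_le (h * r * r * r)]

end QuantumCode

/-! ### Choice of the two codes -/

theorem mainTheorem1 {F : Type*} [Field F] [Fintype F] (q m n c : ℕ)
    (hF : Fintype.card F = q) (hq : 3 ≤ q) (hm : 2 ≤ m) (hm_even : Even m)
    (hn : n = q ^ m - 1) (hc : 2 ≤ c) (hcq : c ≤ q) :
    ∃ k : ℕ, (k : ℤ) = (n : ℤ) - 2 * (m : ℤ) * ((c : ℤ) - 2) - (m : ℤ) / 2 - 1 ∧
      ∃ Q : Submodule ℂ (QuantumCode.StateSpace F n),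
        QuantumCode.IsCSS Q ∧ QuantumCode.HasParameters Q k c := by
  obtain ⟨h, rfl⟩ := hm_even.exists_two_nsmul
  rw [smul_eq_mul] at *
  obtain ⟨e, rfl⟩ := Nat.exists_eq_add_of_le' hc
  have hh : 1 ≤ h := by omega
  have he : e ≤ q - 2 := by omega
  have hqm := QuantumCode.two_mul_mul_add_le_pow hq hh
  have hle : 4 * h * e ≤ 4 * h * (q - 2) := Nat.mul_le_mul_left _ he
  refine ⟨n - (4 * h * e + h + 1), ?_, ?_⟩
  · rw [Nat.cast_sub (by omega)]
    push_cast
    rw [Int.mul_ediv_cancel_left _ two_ne_zero]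
    ring
  obtain ⟨p, hp⟩ := CharP.exists F
  have : Fact p.Prime := ⟨CharP.char_is_prime F p⟩
  have : NeZero (2 * h) := ⟨by omega⟩
  let K := FiniteField.Extension F p (2 * h)
  have : Fintype K := Fintype.ofFinite K
  have hK : Module.finrank F K = 2 * h := FiniteField.finrank_extension F p (2 * h)
  obtain ⟨g, hg⟩ := IsCyclic.exists_ofOrder_eq_natCard (α := Kˣ)
  have hcard : Nat.card Kˣ = n := by
    rw [Nat.card_units, FiniteField.natCard_extension, Nat.card_eq_fintype_card, hF, hn]
  have hα : IsPrimitiveRoot (g : K) n := by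
    rw [← hcard, ← hg, ← orderOf_units]
    exact IsPrimitiveRoot.orderOf _
  have hqh : q ≤ q ^ h := Nat.le_self_pow (by omega) q
  have hpow : q ^ (2 * h) = q ^ h * q ^ h := by rw [two_mul, pow_add]
  have hb : q ^ h + 1 - e + e = q ^ h + 1 := by omega
  refine QuantumCode.exists_isCSS_hasParameters
    (C₁ := QuantumCode.bchCode F n (g : K) (q ^ h + 1 - e) e)
    (C₂ := LinearMap.range (QuantumCode.traceMap F n (g : K) e)) ?_ ?_ ?_ ?_
  · refine QuantumCode.range_traceMap_le_bchCode hα (by omega) fun t ht => ?_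
    rw [hF, hb]
    rw [hK] at ht
    have h1 : q ^ t ≤ q ^ (2 * h - 1) := Nat.pow_le_pow_right (by omega) (by omega)
    have h2 : q ^ h ≤ q ^ (2 * h - 1) := Nat.pow_le_pow_right (by omega) (by omega)
    have h3 : q ^ (2 * h) = q * q ^ (2 * h - 1) := by
      rw [← pow_succ']
      congr 1
      omega
    -- Two copies of `q^(2h-1)` are left over: one absorbs `q^h`, the other the remaining constants.
    have h4 : e * q ^ t ≤ (q - 2) * q ^ (2 * h - 1) := Nat.mul_le_mul he h1
    have h5 : (q - 2) * q ^ (2 * h - 1) + 2 * q ^ (2 * h - 1) = q * q ^ (2 * h - 1) := by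
      rw [← add_mul]
      congr 1
      omega
    omega
  · have h1 := QuantumCode.finrank_range_traceMap_le (F := F) (n := n) (α := (g : K)) e
    have h2 := QuantumCode.le_finrank_bchCode (F := F) (n := n) (α := (g : K)) (b := q ^ h + 1 - e)
      (e := e) (h := h) (by omega) (by
        -- Since `q^(2h) ≡ 1` modulo `n`, multiplication by `q^h` fixes `q^h + 1`.
        have h3 : (q ^ h + 1) * q ^ h = n + (q ^ h + 1) := by
          have : 0 < q ^ h * q ^ h := by positivity
          rw [add_mul, one_mul]
          omega
        rw [hF, hb, ← pow_mul, h3, pow_add, hα.pow_eq_one, one_mul])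
    rw [hK] at h1 h2
    have h4 : e * (2 * h) + e * (2 * h) = 4 * h * e := by ring
    omega
  · exact fun S hS x hx hxS => QuantumCode.eq_zero_of_mem_bchCode hα hS hx hxS
  · exact fun S hS x hxS hx => QuantumCode.eq_zero_of_mem_bchCode hα hS
      (QuantumCode.mem_bchCode_of_orthogonal_range_traceMap hx) hxS
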